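/- **Setting.** There are $n$ parties $\mathcal P=\{P_1,\dots,P_n\}$ connected by pairwise authenticated links, a countable input set $V_{\mathrm{in}}$ and a non-empty output set $V_{\mathrm{out}}$. An adversary statically corrupts some parties, which may then deviate arbitrarily from the protocol; it sees all messages and controls message delivery. Protocols may be randomized, with public and private randomness of arbitrary joint law, and may use a cryptographic setup with perfectly unforgeable signatures (the case without signatures is included): a corrupted party can send a signature of an honest party only if it occurs in a message that was sent earlier. Time is discrete and a message takes at least one time step. In a *synchronous* network all honest parties take a step at every time step and every message is delivered within a known bound $\Delta\ge 1$; in an *asynchronous* network every honest party takes infinitely many steps and every message is eventually delivered. The parties do not know which of the two holds. An *input configuration* $I$ assigns to each party of a set $\mathcal P(I)\subseteq\mathcal P$ (the honest parties) with $|\mathcal P(I)|\ge n-t_s$ an input in $V_{\mathrm{in}}$; let $\mathcal I$ be the set of all of them. A *validity property* is a map $V:\mathcal I\to 2^{V_{\mathrm{out}}}$; it is *trivial* if $\bigcap_{I\in\mathcal I}V(I)\neq\emptyset$. For $t_a\le t_s$, a protocol is a *$(t_s,t_a)$-secure Byzantine Agreement (BA) protocol solving $V$* if the following three properties hold in every synchronous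 network with at most $t_s$ corrupted parties and in every asynchronous network with at most $t_a$ corrupted parties, for every input configuration $I$ and every adversary strategy: (probabilistic termination) for each honest party, the probability that it has not decided by time $t$ tends to $0$ as $t\to\infty$; (agreement) almost surely, no two honest parties output different values; (validity) almost surely, no honest party outputs a value outside $V(I)$. **Theorem.** Let $t_s>0$, $n=2t_s$, and let $V$ be any validity property. If there is a $(t_s,0)$-secure BA protocol solving $V$, then $V$ is trivial. -/

import Mathlib

open MeasureTheory Filter Topology

namespace NetworkAgnosticBA

/-- An input configuration: `input i = some v` says that party `i` is honest and holds the input `v`,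
`input i = none` says that party `i` is corrupted.  At most `ts` of the `n` parties are corrupted. -/
structure InputConfig (n ts : ℕ) (Vin : Type*) where
  input : Fin n → Option Vin
  card_ge : n ≤ (Finset.univ.filter fun i => (input i).isSome).card + ts

/-- The set of honest parties of an input configuration. -/
def InputConfig.parties {n ts : ℕ} {Vin : Type*} (I : InputConfig n ts Vin) : Finset (Fin n) :=
  Finset.univ.filter fun i => (I.input i).isSome

/-- A validity property assigns to every input configuration the set of valid outputs. -/
def ValidityProperty (n ts : ℕ) (Vin Vout : Type*) := InputConfig n ts Vin → Set Vout

/-- A validity property is trivial if some value is valid for all input configurations. -/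
def ValidityProperty.IsTrivial {n ts : ℕ} {Vin Vout : Type*}
    (V : ValidityProperty n ts Vin Vout) : Prop :=
  (⋂ I, V I).Nonempty

/-- What a party receives in one activation: from every sender (links are authenticated) a finite
multiset of messages. -/
abbrev Batch (n : ℕ) (M : Type*) := Fin n → Multiset M

/-- The messages that were sent in one time step: `x j i` is the message from `j` to `i`, if any. -/
abbrev Traffic (n : ℕ) (M : Type*) := Fin n → Fin n → Option M

/-- A (randomized) protocol for `n` parties with messages in `M`.

The randomness is a pair of a public part and a private part for every party, with an arbitrary joint
law; this includes common coins and trusted setups.  `sig m` is the set of the signatures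
`(signer, signed content)` that are contained in the message `m` (a model of perfectly unforgeable
signatures; it is empty for all messages if there is no cryptographic setup).

In each activation an honest party receives a batch of messages, and then sends at most one message
to every party.  Its local history is the list of the batches received in its activations so far
(the length of the list is its local clock), and its behaviour is a function of its input, the public
randomness, its private randomness and its local history. -/
structure Protocol (n : ℕ) (Vin Vout M : Type*) {C : Type*} (sig : M → Set (Fin n × C))
    (Pub Priv : Type*) [MeasurableSpace Pub] [MeasurableSpace Priv] where
  /-- The joint law of the randomness. -/
  law : Measure (Pub × (Fin n → Priv))
  isProb : IsProbabilityMeasure law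
  /-- The messages that a party sends in an activation; the current batch is the last entry of the
  history. -/
  send : Fin n → Vin → Pub → Priv → List (Batch n M) → Fin n → Option M
  /-- The output of a party; `none` as long as it has not decided. -/
  output : Fin n → Vin → Pub → Priv → List (Batch n M) → Option Vout
  /-- A decision is final. -/
  output_final : ∀ i v p r h b w, output i v p r h = some w → output i v p r (h ++ [b]) = some w
  /-- A party can only use its own signatures and those that it has received. -/
  send_sig : ∀ i v p r h k m, send i v p r h k = some m → ∀ x ∈ sig m,
    x.1 = i ∨ ∃ b ∈ h, ∃ j, ∃ m' ∈ b j, x ∈ sig m'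

/-- What the adversary knows in a time step: the public randomness, the private randomness of the
corrupted parties, and all messages sent in the earlier time steps (in this order). -/
structure AdvView (n : ℕ) (M Pub Priv : Type*) where
  pub : Pub
  coins : Fin n → Option Priv
  transcript : List (Traffic n M)

/-- An adversary strategy.  In every time step, depending on its view, the adversary decides which
messages the corrupted parties send, which parties are activated, and which of the messages in
transit are delivered. -/
structure Adversary (n : ℕ) (M Pub Priv : Type*) where
  /-- `send x j i` is the message (if any) from the corrupted party `j` to `i`. -/
  send : AdvView n M Pub Priv → Fin n → Fin n → Option M
  activate : AdvView n M Pub Priv → Fin n → Bool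
  /-- `deliver x j i s`: deliver the message sent by `j` to `i` in time step `s`, provided it is in
  transit and `i` is activated. -/
  deliver : AdvView n M Pub Priv → Fin n → Fin n → ℕ → Bool

/-- A global configuration of the system. -/
structure Config (n : ℕ) (M : Type*) where
  /-- The messages sent so far, one entry for every time step. -/
  transcript : List (Traffic n M)
  /-- `inTransit j i s` is the message that `j` sent to `i` in time step `s`, if there is such a
  message and it has not been delivered yet. -/
  inTransit : Fin n → Fin n → ℕ → Option M
  /-- The local histories of the parties. -/
  history : Fin n → List (Batch n M)

section Execution

variable {n ts : ℕ} {Vin Vout M C : Type*} {sig : M → Set (Fin n × C)} {Pub Priv : Type*}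
  [MeasurableSpace Pub] [MeasurableSpace Priv]

/-- The view of the adversary in the configuration `c`. -/
def advView (I : InputConfig n ts Vin) (ω : Pub × (Fin n → Priv)) (c : Config n M) :
    AdvView n M Pub Priv where
  pub := ω.1
  coins i := if (I.input i).isSome then none else some (ω.2 i)
  transcript := c.transcript

/-- Time step `t` of an execution.  First the activated parties receive the messages that are
delivered to them, then the activated honest parties and the corrupted parties send messages. -/
def step (P : Protocol n Vin Vout M sig Pub Priv) (I : InputConfig n ts Vin)
    (A : Adversary n M Pub Priv) (ω : Pub × (Fin n → Priv)) (t : ℕ) (c : Config n M) :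
    Config n M :=
  let x := advView I ω c
  let delivered : Fin n → Fin n → ℕ → Bool := fun j i s => A.activate x i && A.deliver x j i s
  let batch : Fin n → Batch n M := fun i j =>
    ∑ s ∈ Finset.range t, if delivered j i s then (c.inTransit j i s).elim 0 (fun m => {m}) else 0
  let history : Fin n → List (Batch n M) := fun i =>
    if A.activate x i then c.history i ++ [batch i] else c.history i
  let sent : Traffic n M := fun j i =>
    match I.input j with
    | some v => if A.activate x j then P.send j v ω.1 (ω.2 j) (history j) i else none
    | none => A.send x j i
  { transcript := c.transcript ++ [sent]
    inTransit := fun j i s =>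
      if s = t then sent j i else if delivered j i s then none else c.inTransit j i s
    history := history }

/-- `run P I A ω t` is the configuration before time step `t` in the execution that is given by the
protocol, the input configuration, the adversary and the randomness. -/
def run (P : Protocol n Vin Vout M sig Pub Priv) (I : InputConfig n ts Vin)
    (A : Adversary n M Pub Priv) (ω : Pub × (Fin n → Priv)) : ℕ → Config n M
  | 0 => { transcript := [], inTransit := fun _ _ _ => none, history := fun _ => [] }
  | t + 1 => step P I A ω t (run P I A ω t)

/-- The view of the adversary in time step `t`. -/
def viewAt (P : Protocol n Vin Vout M sig Pub Priv) (I : InputConfig n ts Vin)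
    (A : Adversary n M Pub Priv) (ω : Pub × (Fin n → Priv)) (t : ℕ) : AdvView n M Pub Priv :=
  advView I ω (run P I A ω t)

/-- The output of the honest party `i` before time step `t`, if it has decided by then. -/
def outputAt (P : Protocol n Vin Vout M sig Pub Priv) (I : InputConfig n ts Vin)
    (A : Adversary n M Pub Priv) (ω : Pub × (Fin n → Priv)) (t : ℕ) (i : Fin n) : Option Vout :=
  match I.input i with
  | some v => P.output i v ω.1 (ω.2 i) ((run P I A ω t).history i)
  | none => none

/-- The adversary does not forge signatures: whenever a corrupted party sends a message with a
signature of an honest party, this signature occurs in a message that was sent earlier. -/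
def Unforgeable (P : Protocol n Vin Vout M sig Pub Priv) (I : InputConfig n ts Vin)
    (A : Adversary n M Pub Priv) : Prop :=
  ∀ ω t j i m, j ∉ I.parties → A.send (viewAt P I A ω t) j i = some m →
    ∀ x ∈ sig m, x.1 ∈ I.parties →
      ∃ y ∈ (run P I A ω t).transcript, ∃ j' i' m', y j' i' = some m' ∧ x ∈ sig m'

/-- The network is synchronous: the honest parties are activated in all time steps (so that their
local clocks agree), and every message to them is delivered at most `Δ` time steps after it was
sent. -/
def Synchronous (Δ : ℕ) (P : Protocol n Vin Vout M sig Pub Priv) (I : InputConfig n ts Vin)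
    (A : Adversary n M Pub Priv) : Prop :=
  ∀ ω, ∀ i ∈ I.parties,
    (∀ t, A.activate (viewAt P I A ω t) i = true) ∧
    (∀ j s, (run P I A ω (s + Δ + 1)).inTransit j i s = none)

/-- The network is asynchronous: every honest party is activated infinitely often, and every message
to it is eventually delivered. -/
def Asynchronous (P : Protocol n Vin Vout M sig Pub Priv) (I : InputConfig n ts Vin)
    (A : Adversary n M Pub Priv) : Prop :=
  ∀ ω, ∀ i ∈ I.parties,
    (∀ t, ∃ t' ≥ t, A.activate (viewAt P I A ω t') i = true) ∧
    (∀ j s, ∃ t > s, (run P I A ω t).inTransit j i s = none)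

/-- As time goes to infinity, the probability that an honest party has not decided tends to 0. -/
def ProbabilisticTermination (P : Protocol n Vin Vout M sig Pub Priv) (I : InputConfig n ts Vin)
    (A : Adversary n M Pub Priv) : Prop :=
  ∀ i ∈ I.parties, Tendsto (fun t => P.law {ω | outputAt P I A ω t i = none}) atTop (𝓝 0)

/-- No two honest parties output different values (with probability 1). -/
def Agreement (P : Protocol n Vin Vout M sig Pub Priv) (I : InputConfig n ts Vin)
    (A : Adversary n M Pub Priv) : Prop :=
  ∀ᵐ ω ∂P.law, ∀ i ∈ I.parties, ∀ j ∈ I.parties, ∀ t t' w w',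
    outputAt P I A ω t i = some w → outputAt P I A ω t' j = some w' → w = w'

/-- No honest party outputs an invalid value (with probability 1). -/
def Validity (V : ValidityProperty n ts Vin Vout) (P : Protocol n Vin Vout M sig Pub Priv)
    (I : InputConfig n ts Vin) (A : Adversary n M Pub Priv) : Prop :=
  ∀ᵐ ω ∂P.law, ∀ i ∈ I.parties, ∀ t w, outputAt P I A ω t i = some w → w ∈ V I

/-- `P` is a `(ts, ta)`-secure Byzantine Agreement protocol solving `V`, where `Δ` is the publicly
known bound on the message delays of a synchronous network and `ta ≤ ts`.  The set of corrupted
parties, which is given by the input configuration, is chosen before the execution. -/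
structure IsSecureBA (Δ ta : ℕ) (V : ValidityProperty n ts Vin Vout)
    (P : Protocol n Vin Vout M sig Pub Priv) : Prop where
  sync : ∀ (I : InputConfig n ts Vin) (A : Adversary n M Pub Priv),
    Unforgeable P I A → Synchronous Δ P I A →
      ProbabilisticTermination P I A ∧ Agreement P I A ∧ Validity V P I A
  async : ∀ (I : InputConfig n ts Vin) (A : Adversary n M Pub Priv), n ≤ I.parties.card + ta →
    Unforgeable P I A → Asynchronous P I A →
      ProbabilisticTermination P I A ∧ Agreement P I A ∧ Validity V P I A

end Execution

end NetworkAgnosticBA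

/-! Split the parties into halves `S` and `Sᶜ` of size `ts`. In a synchronous network either half
may be corrupted, so `S` must decide even if `Sᶜ` follows the protocol and falls silent in step `q`
(`crashKeep`). In an asynchronous network with all parties honest, the messages from `S` to `Sᶜ` can
be withheld from step `p` on, and those in the other direction from step `q` on (`cutKeep`). If `q ≤
p + 1`, then `S` cannot tell this cut from a crash of `Sᶜ` in step `q`; the same holds with the
halves exchanged (`decides_crashKeep_iff_decides_cutKeep`). So agreement equates the decisions of
the two halves whenever `p` and `q` differ by at most one.

This chain links all crash times to crash time 0, where the decision of a half depends on its own
inputs only. Mixing inputs then yields one value `y` that is decided for all inputs and crash times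
(`exists_forall_decides_eq`). A decision without a crash is made in finite time, so a late enough
crash does not affect it and it equals `y`; validity gives `y ∈ V I`. Countability of `Vin` lets a
single `ω` avoid all exceptional null sets. -/

namespace NetworkAgnosticBA

/-! ### Ideal executions and causal indistinguishability -/

section IdealExecution

variable {n ts : ℕ} {Vin Vout M C : Type*} {sig : M → Set (Fin n × C)} {Pub Priv : Type*}
  [MeasurableSpace Pub] [MeasurableSpace Priv]

/-- An optional message as a multiset of messages. -/
def toBatch (o : Option M) : Multiset M := o.elim 0 fun m => {m}

open Classical in
/-- The local histories in the ideal execution in which all parties are honest and always activated,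
and the message that `j` sends to `i` in time step `u` is delivered in the next time step if
`keep u j i` holds, and lost otherwise. -/
noncomputable def idealHist (P : Protocol n Vin Vout M sig Pub Priv) (s : Fin n → Vin)
    (ω : Pub × (Fin n → Priv)) (keep : ℕ → Fin n → Fin n → Prop) :
    ℕ → Fin n → List (Batch n M)
  | 0 => fun _ => []
  | 1 => fun _ => [0]
  | t + 2 => fun i => idealHist P s ω keep (t + 1) i ++ [fun j =>
      if keep t j i then
        toBatch (P.send j (s j) ω.1 (ω.2 j) (idealHist P s ω keep (t + 1) j) i) else 0]

/-- Two ideal executions look the same for the parties in `R t` up to time `t` if these parties have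
the same inputs and receive the same messages, which come from parties for which the two executions
looked the same before. -/
theorem idealHist_congr (P : Protocol n Vin Vout M sig Pub Priv) {s s' : Fin n → Vin}
    (ω : Pub × (Fin n → Priv)) {keep keep' : ℕ → Fin n → Fin n → Prop} (R : ℕ → Fin n → Prop)
    (hmono : ∀ t i, R (t + 1) i → R t i) (hs : ∀ t i, R t i → s i = s' i)
    (hkeep : ∀ t i, R (t + 2) i → ∀ j, (keep t j i ↔ keep' t j i) ∧ (keep t j i → R (t + 1) j))
    (t : ℕ) : ∀ i, R t i → idealHist P s ω keep t i = idealHist P s' ω keep' t i := by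
  induction t with
  | zero => intro i _; rfl
  | succ t ih =>
    cases t with
    | zero => intro i _; rfl
    | succ t =>
      intro i hi
      simp only [idealHist]
      rw [ih i (hmono _ _ hi)]
      congr 2
      funext j
      obtain ⟨h1, h2⟩ := hkeep t i hi j
      by_cases hk : keep t j i
      · rw [if_pos hk, if_pos (h1.1 hk), ih j (h2 hk), hs _ j (h2 hk)]
      · rw [if_neg hk, if_neg fun h => hk (h1.2 h)]

/-! ### Adversaries that realise ideal executions -/

/-- The local history of party `i` in a synchronous execution in which every message is delivered
in the next time step. -/
def simHist (l : List (Traffic n M)) (i : Fin n) : List (Batch n M) :=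
  0 :: l.map fun x j => toBatch (x j i)

open Classical in
/-- All parties are always activated, and a message is delivered in the next time step if `keep`
holds, and not before time step `T` otherwise.  The corrupted parties follow the protocol for a
synchronous execution with inputs `s` in the time steps before `q`, and are silent afterwards. -/
noncomputable def schedAdv (P : Protocol n Vin Vout M sig Pub Priv) (s : Fin n → Vin)
    (keep : ℕ → Fin n → Fin n → Prop) (T : ℕ) (q : ℕ∞) : Adversary n M Pub Priv where
  send x j i := (x.coins j).elim none fun ρ =>
    if (x.transcript.length : ℕ∞) < q then P.send j (s j) x.pub ρ (simHist x.transcript j) i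
    else none
  activate _ _ := true
  deliver x j i u :=
    decide (if keep u j i then x.transcript.length = u + 1 else T ≤ x.transcript.length)

variable (P : Protocol n Vin Vout M sig Pub Priv) (I : InputConfig n ts Vin)
  (s : Fin n → Vin) (keep : ℕ → Fin n → Fin n → Prop) (T : ℕ) (q : ℕ∞)
  (ω : Pub × (Fin n → Priv))

theorem send_schedAdv {j : Fin n} (hj : I.input j = none) (c : Config n M) (i : Fin n) :
    (schedAdv P s keep T q).send (advView I ω c) j i =
      if (c.transcript.length : ℕ∞) < q then
        P.send j (s j) ω.1 (ω.2 j) (simHist c.transcript j) i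
      else none := by
  simp [schedAdv, advView, hj]

theorem deliver_schedAdv (x : AdvView n M Pub Priv) (j i : Fin n) (u : ℕ) :
    (schedAdv P s keep T q).deliver x j i u = true ↔
      (keep u j i ∧ x.transcript.length = u + 1) ∨ (¬keep u j i ∧ T ≤ x.transcript.length) := by
  by_cases h : keep u j i <;> simp [schedAdv, h]

theorem length_transcript_run (A : Adversary n M Pub Priv) (t : ℕ) :
    (run P I A ω t).transcript.length = t := by
  induction t with
  | zero => rfl
  | succ t ih => simp [run, step, ih]

theorem transcript_run_succ (A : Adversary n M Pub Priv) (t : ℕ) :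
    (run P I A ω (t + 1)).transcript =
      (run P I A ω t).transcript ++ [fun j i => (run P I A ω (t + 1)).inTransit j i t] := by
  simp [run, step]

theorem inTransit_run_succ_of_ne (A : Adversary n M Pub Priv) {t u : ℕ} (h : u ≠ t)
    (j i : Fin n) :
    (run P I A ω (t + 1)).inTransit j i u =
      if A.activate (viewAt P I A ω t) i && A.deliver (viewAt P I A ω t) j i u then none
      else (run P I A ω t).inTransit j i u := by
  simp [run, step, h, viewAt]

theorem inTransit_run_none_of_le (A : Adversary n M Pub Priv) {u t t' : ℕ} (h : t ≤ t')
    (hu : u < t) (j i : Fin n) (h0 : (run P I A ω t).inTransit j i u = none) :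
    (run P I A ω t').inTransit j i u = none := by
  induction t', h using Nat.le_induction with
  | base => exact h0
  | succ t' ht ih =>
    rw [inTransit_run_succ_of_ne P I ω A (by omega)]
    simp [ih]

/-- The messages that are sent in time step `t`. -/
theorem inTransit_run_schedAdv (t : ℕ) (j i : Fin n)
    (hs : ∀ i ∈ I.parties, I.input i = some (s i)) :
    (run P I (schedAdv P s keep T q) ω (t + 1)).inTransit j i t =
      if j ∈ I.parties then P.send j (s j) ω.1 (ω.2 j)
        ((run P I (schedAdv P s keep T q) ω (t + 1)).history j) i
      else if (t : ℕ∞) < q then P.send j (s j) ω.1 (ω.2 j)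
        (simHist (run P I (schedAdv P s keep T q) ω t).transcript j) i
      else none := by
  by_cases hj : j ∈ I.parties
  · have h := hs j hj
    simp [run, step, h, hj, schedAdv]
  · have h : I.input j = none := by
      simpa [InputConfig.parties] using hj
    rw [if_neg hj]
    simp only [run, step, h, if_true]
    rw [send_schedAdv P I s keep T q ω h, length_transcript_run]

theorem history_run_schedAdv_one (i : Fin n) :
    (run P I (schedAdv P s keep T q) ω 1).history i = [0] := by
  simp [run, step, schedAdv]
  rfl

-- Before step `T` no withheld message arrives, so the batch of step `t + 1` consists only of
-- messages sent in step `t`.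
open Classical in
theorem history_run_schedAdv_succ (t : ℕ) (i : Fin n) (ht : t + 1 < T ∨ ∀ u j i, keep u j i) :
    (run P I (schedAdv P s keep T q) ω (t + 2)).history i =
      (run P I (schedAdv P s keep T q) ω (t + 1)).history i ++ [fun j =>
        if keep t j i then toBatch ((run P I (schedAdv P s keep T q) ω (t + 1)).inTransit j i t)
        else 0] := by
  set A := schedAdv P s keep T q with hA
  have hact : ∀ x i, A.activate x i = true := fun _ _ => rfl
  rw [run, step]
  simp only [hact, if_true, Bool.true_and]
  congr 2
  funext j
  have hlen : (advView I ω (run P I A ω (t + 1)) : AdvView n M Pub Priv).transcript.length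
      = t + 1 := length_transcript_run P I ω A (t + 1)
  have hdel : ∀ u, u < t + 1 →
      (A.deliver (advView I ω (run P I A ω (t + 1))) j i u = true ↔ u = t ∧ keep t j i) := by
    intro u hu
    rw [hA, deliver_schedAdv, ← hA, hlen]
    constructor
    · rintro (⟨hk, h⟩ | ⟨hk, h⟩)
      · obtain rfl : u = t := by omega
        exact ⟨rfl, hk⟩
      · rcases ht with ht | ht
        · omega
        · exact absurd (ht _ _ _) hk
    · rintro ⟨rfl, hk⟩
      exact Or.inl ⟨hk, rfl⟩
  rw [Finset.sum_eq_single_of_mem t (by simp)]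
  · by_cases hk : keep t j i
    · rw [if_pos hk, if_pos ((hdel t (by omega)).2 ⟨rfl, hk⟩)]
      rfl
    · rw [if_neg hk, if_neg fun h => hk ((hdel t (by omega)).1 h).2]
  · intro u hu hne
    rw [if_neg fun h => hne ((hdel u (by simpa using hu)).1 h).1]

/-- If all messages are delivered in the next time step, then the history of a party can be
computed from the transcript. -/
theorem simHist_transcript_run (hk : ∀ u j i, keep u j i) (t : ℕ) (i : Fin n) :
    simHist (run P I (schedAdv P s keep T q) ω t).transcript i =
      (run P I (schedAdv P s keep T q) ω (t + 1)).history i := by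
  induction t with
  | zero =>
    rw [history_run_schedAdv_one]
    rfl
  | succ t ih =>
    rw [history_run_schedAdv_succ _ _ _ _ _ _ _ _ _ (Or.inr hk), ← ih, transcript_run_succ]
    simp [simHist, hk]

/-- Corrupted parties recover their true histories from the transcript, so they act as honest
parties until they crash in step `q`. -/
theorem history_run_sync (hs : ∀ i ∈ I.parties, I.input i = some (s i)) (t : ℕ) (i : Fin n) :
    (run P I (schedAdv P s (fun _ _ _ => True) 0 q) ω t).history i =
      idealHist P s ω (fun u j _ => j ∈ I.parties ∨ (u : ℕ∞) < q) t i := by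
  induction t generalizing i with
  | zero => rfl
  | succ t ih =>
    cases t with
    | zero => rw [history_run_schedAdv_one]; rfl
    | succ t =>
      rw [history_run_schedAdv_succ _ _ _ _ _ _ _ _ _ (Or.inr fun _ _ _ => trivial), idealHist, ih]
      congr 2
      funext j
      rw [if_pos trivial, inTransit_run_schedAdv _ _ _ _ _ _ _ _ _ _ hs,
        simHist_transcript_run _ _ _ _ _ _ _ fun _ _ _ => trivial, ih]
      by_cases h1 : j ∈ I.parties <;> by_cases h2 : (t : ℕ∞) < q <;> simp [h1, h2, toBatch]

/-- Losing messages forever is not allowed in an asynchronous network, but up to time `T` delay and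
loss look the same. -/
theorem history_run_async (hs : ∀ i, I.input i = some (s i)) (t : ℕ) (ht : t ≤ T) (i : Fin n) :
    (run P I (schedAdv P s keep T q) ω t).history i = idealHist P s ω keep t i := by
  induction t generalizing i with
  | zero => rfl
  | succ t ih =>
    cases t with
    | zero => rw [history_run_schedAdv_one]; rfl
    | succ t =>
      have hI : ∀ j, j ∈ I.parties := fun j => by simp [InputConfig.parties, hs]
      rw [history_run_schedAdv_succ _ _ _ _ _ _ _ _ _ (Or.inl (by omega)), idealHist,
        ih (by omega)]
      congr 2
      funext j
      rw [inTransit_run_schedAdv _ _ _ _ _ _ _ _ _ _ fun i _ => hs i, if_pos (hI j),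
        ih (by omega)]

/-- Corrupted parties send only what the protocol prescribes on a history read off the transcript,
so `send_sig` limits them to their own signatures and those already sent. -/
theorem unforgeable_schedAdv : Unforgeable P I (schedAdv P s keep T q) := by
  intro ω t j i m hj hm x hx hxI
  have hin : I.input j = none := by simpa [InputConfig.parties] using hj
  have hm' : P.send j (s j) ω.1 (ω.2 j)
      (simHist (run P I (schedAdv P s keep T q) ω t).transcript j) i = some m := by
    rw [viewAt, send_schedAdv P I s keep T q ω hin] at hm
    split_ifs at hm
    exact hm
  rcases P.send_sig _ _ _ _ _ _ _ hm' x hx with h | ⟨b, hb, k, m', hm'b, hxm⟩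
  · exact absurd (h ▸ hxI) hj
  · simp only [simHist, List.mem_cons, List.mem_map] at hb
    rcases hb with rfl | ⟨y, hy, rfl⟩
    · simp at hm'b
    · refine ⟨y, hy, k, j, m', ?_, hxm⟩
      cases h : y k j <;> simp_all [toBatch]

theorem inTransit_run_schedAdv_eq_none {t u : ℕ} (j i : Fin n) (hu : u < t)
    (h : (keep u j i ∧ t = u + 1) ∨ (¬keep u j i ∧ T ≤ t)) :
    (run P I (schedAdv P s keep T q) ω (t + 1)).inTransit j i u = none := by
  rw [inTransit_run_succ_of_ne P I ω _ hu.ne, (deliver_schedAdv P s keep T q _ j i u).2]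
  · rfl
  · have hlen : (viewAt P I (schedAdv P s keep T q) ω t).transcript.length = t :=
      length_transcript_run P I ω _ t
    rwa [hlen]

theorem synchronous_schedAdv {Δ : ℕ} (hΔ : 0 < Δ) :
    Synchronous Δ P I (schedAdv P s (fun _ _ _ => True) 0 q) := by
  refine fun ω i _ => ⟨fun _ => rfl, fun j u => ?_⟩
  exact inTransit_run_none_of_le P I ω _ (t := u + 1 + 1) (by omega) (by omega) j i
    (inTransit_run_schedAdv_eq_none P I s _ 0 q ω j i (by omega) (by simp))

theorem asynchronous_schedAdv : Asynchronous P I (schedAdv P s keep T q) := by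
  refine fun ω i _ => ⟨fun t => ⟨t, le_rfl, rfl⟩, fun j u => ?_⟩
  by_cases hk : keep u j i
  · exact ⟨u + 1 + 1, by omega,
      inTransit_run_schedAdv_eq_none P I s keep T q ω j i (by omega) (by simp [hk])⟩
  · exact ⟨max T (u + 1) + 1, by omega,
      inTransit_run_schedAdv_eq_none P I s keep T q ω j i (by omega) (by simp [hk])⟩

end IdealExecution

/-! ### Decisions under crashes and cuts -/

section Decision

variable {n ts Δ : ℕ} {Vin Vout M C : Type*} {sig : M → Set (Fin n × C)} {Pub Priv : Type*}
  [MeasurableSpace Pub] [MeasurableSpace Priv] {P : Protocol n Vin Vout M sig Pub Priv}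

/-- The party `i` decides on `w` in an ideal execution. -/
def Decides (P : Protocol n Vin Vout M sig Pub Priv) (ω : Pub × (Fin n → Priv)) (s : Fin n → Vin)
    (keep : ℕ → Fin n → Fin n → Prop) (i : Fin n) (w : Vout) : Prop :=
  ∃ t, P.output i (s i) ω.1 (ω.2 i) (idealHist P s ω keep t i) = some w

/-- The messages that are delivered if the parties outside `S` crash in time step `q`. -/
def crashKeep (S : Finset (Fin n)) (q : ℕ∞) : ℕ → Fin n → Fin n → Prop :=
  fun u j _ => j ∈ S ∨ (u : ℕ∞) < q

/-- The messages that are delivered if the link from `S` to its complement breaks in time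
step `p`, and the link from the complement of `S` to `S` breaks in time step `q`. -/
def cutKeep (S : Finset (Fin n)) (p q : ℕ) : ℕ → Fin n → Fin n → Prop :=
  fun u j i => (j ∈ S ↔ i ∈ S) ∨ (j ∈ S ∧ u < p) ∨ (i ∈ S ∧ u < q)

theorem cutKeep_compl (S : Finset (Fin n)) (p q : ℕ) : cutKeep Sᶜ q p = cutKeep S p q := by
  funext u j i
  simp only [cutKeep, Finset.mem_compl, eq_iff_iff]
  tauto

/-- The input configuration in which the parties in `S` are honest and have the inputs `s`. -/
def restrictInputs (s : Fin n → Vin) (S : Finset (Fin n)) (h : n ≤ S.card + ts) :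
    InputConfig n ts Vin where
  input i := if i ∈ S then some (s i) else none
  card_ge := by
    convert h
    ext i
    by_cases hi : i ∈ S <;> simp [hi]

theorem parties_restrictInputs (s : Fin n → Vin) (S : Finset (Fin n)) (h : n ≤ S.card + ts) :
    (restrictInputs s S h).parties = S := by
  ext i
  by_cases hi : i ∈ S <;> simp [InputConfig.parties, restrictInputs, hi]

theorem input_restrictInputs (s : Fin n → Vin) (S : Finset (Fin n)) (h : n ≤ S.card + ts)
    {i : Fin n} (hi : i ∈ S) : (restrictInputs s S h).input i = some (s i) := if_pos hi

/-- What `S` hears from `Sᶜ` was sent before step `q`, so it can only reflect messages of `S` sent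
before step `q - 1 ≤ p`, which the cut lets through. -/
theorem decides_crashKeep_iff_decides_cutKeep {ω : Pub × (Fin n → Priv)} {s : Fin n → Vin}
    {S : Finset (Fin n)} {p q : ℕ} (hpq : q ≤ p + 1) {i : Fin n} (hi : i ∈ S) {w : Vout} :
    Decides P ω s (crashKeep S q) i w ↔ Decides P ω s (cutKeep S p q) i w := by
  refine exists_congr fun t => ?_
  -- The parties outside `S` need to look the same only up to time `q`: a message of step `u < q` is
  -- computed from the history at time `u + 1 ≤ q`.
  rw [idealHist_congr P ω (keep := crashKeep S q) (keep' := cutKeep S p q)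
    (fun t i => i ∈ S ∨ t ≤ q) ?_ (fun _ _ _ => rfl) ?_ t i (Or.inl hi)]
  · rintro t i (h | h)
    · exact Or.inl h
    · exact Or.inr (by omega)
  · intro t i h j
    simp only [crashKeep, cutKeep, Nat.cast_lt]
    by_cases hj : j ∈ S <;> by_cases hi : i ∈ S <;> simp [hi, hj] at h ⊢ <;> omega

theorem decides_crashKeep_zero_congr {ω : Pub × (Fin n → Priv)} {s s' : Fin n → Vin}
    {S : Finset (Fin n)} (hs : ∀ i ∈ S, s i = s' i) {i : Fin n} (hi : i ∈ S) {w : Vout} :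
    Decides P ω s (crashKeep S (0 : ℕ)) i w ↔ Decides P ω s' (crashKeep S (0 : ℕ)) i w := by
  refine exists_congr fun t => ?_
  rw [hs i hi, idealHist_congr P ω (keep := crashKeep S (0 : ℕ)) (keep' := crashKeep S (0 : ℕ))
    (s := s) (s' := s') (fun _ i => i ∈ S) (fun _ _ h => h) (fun _ => hs) ?_ t i hi]
  intro t i h j
  simp [crashKeep]

/-- A decision at time `t` depends only on messages sent before `t`, so crashes from step `t` on
come too late, whichever set crashes. -/
theorem exists_decides_crashKeep_nat {ω : Pub × (Fin n → Priv)} {s : Fin n → Vin}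
    {S S' : Finset (Fin n)} {i : Fin n} {w : Vout} (h : Decides P ω s (crashKeep S' ⊤) i w) :
    ∃ q : ℕ, Decides P ω s (crashKeep S q) i w := by
  obtain ⟨t, ht⟩ := h
  refine ⟨t, t, ?_⟩
  rw [← ht, idealHist_congr P ω (keep := crashKeep S t) (keep' := crashKeep S' ⊤)
    (fun u _ => u ≤ t) (fun _ _ h => by omega) (fun _ _ _ => rfl) ?_ t i le_rfl]
  intro u i h j
  have : (u : ℕ∞) < t := by exact_mod_cast (by omega : u < t)
  simp only [crashKeep, this, ENat.natCast_lt_top, or_true, true_imp_iff, true_and]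
  omega

/-! ### Almost sure guarantees for ideal executions -/

theorem outputAt_sync (I : InputConfig n ts Vin) {s : Fin n → Vin}
    (hs : ∀ i ∈ I.parties, I.input i = some (s i)) (q : ℕ∞) (ω : Pub × (Fin n → Priv)) (t : ℕ)
    {i : Fin n} (hi : i ∈ I.parties) :
    outputAt P I (schedAdv P s (fun _ _ _ => True) 0 q) ω t i =
      P.output i (s i) ω.1 (ω.2 i) (idealHist P s ω (crashKeep I.parties q) t i) := by
  simp only [outputAt, hs i hi]
  rw [history_run_sync P I s q ω hs]
  rfl

theorem sync_ae {V : ValidityProperty n ts Vin Vout} (hΔ : 0 < Δ) (hP : IsSecureBA Δ 0 V P)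
    (I : InputConfig n ts Vin) {s : Fin n → Vin}
    (hs : ∀ i ∈ I.parties, I.input i = some (s i)) (q : ℕ∞) :
    ∀ᵐ ω ∂P.law, ∀ i ∈ I.parties, (∃ w, Decides P ω s (crashKeep I.parties q) i w) ∧
      ∀ w, Decides P ω s (crashKeep I.parties q) i w → w ∈ V I := by
  obtain ⟨hterm, -, hval⟩ := hP.sync I _ (unforgeable_schedAdv P I s _ 0 q)
    (synchronous_schedAdv P I s q hΔ)
  have hdec : ∀ᵐ ω ∂P.law, ∀ i, i ∈ I.parties →
      ∃ w, Decides P ω s (crashKeep I.parties q) i w := by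
    rw [ae_all_iff]
    intro i
    by_cases hi : i ∈ I.parties
    · simp only [hi, true_imp_iff]
      -- Never deciding is contained in not having decided by time `t`, for every `t`.
      refine le_antisymm (ge_of_tendsto' (hterm i hi) fun t => measure_mono fun ω hω => ?_)
        zero_le
      simp only [Set.mem_compl_iff, Set.mem_ofPred_eq] at hω ⊢
      rw [outputAt_sync I hs q ω t hi]
      by_contra h
      obtain ⟨w, hw⟩ := Option.ne_none_iff_exists'.1 h
      exact hω ⟨w, t, hw⟩
    · simp [hi]
  filter_upwards [hdec, hval] with ω h1 h2 i hi
  refine ⟨h1 i hi, ?_⟩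
  rintro w ⟨t, ht⟩
  exact h2 i hi t w (by rw [outputAt_sync I hs q ω t hi, ht])

/-- Two decisions in an ideal execution occur by some finite time, so a legal asynchronous execution
that withholds messages until then shows both. Agreement for all the countably many `T` suffices. -/
theorem async_ae {V : ValidityProperty n ts Vin Vout} (hP : IsSecureBA Δ 0 V P)
    (s : Fin n → Vin) (keep : ℕ → Fin n → Fin n → Prop) :
    ∀ᵐ ω ∂P.law, ∀ i j w w', Decides P ω s keep i w → Decides P ω s keep j w' → w = w' := by
  let I : InputConfig n ts Vin := restrictInputs s Finset.univ (by simp)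
  have hI : ∀ i, I.input i = some (s i) :=
    fun i => input_restrictInputs s _ _ (Finset.mem_univ i)
  have hpar : I.parties = Finset.univ := parties_restrictInputs s _ _
  have hagr : ∀ᵐ ω ∂P.law, ∀ T : ℕ, ∀ i ∈ I.parties, ∀ j ∈ I.parties, ∀ t t' w w',
      outputAt P I (schedAdv P s keep T 0) ω t i = some w →
      outputAt P I (schedAdv P s keep T 0) ω t' j = some w' → w = w' :=
    ae_all_iff.2 fun T => (hP.async I _ (by simp [hpar]) (unforgeable_schedAdv P I s keep T 0)
      (asynchronous_schedAdv P I s keep T 0)).2.1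
  filter_upwards [hagr] with ω h i j w w'
  rintro ⟨t, ht⟩ ⟨t', ht'⟩
  refine h (max t t') i (by simp [hpar]) j (by simp [hpar]) t t' w w' ?_ ?_
  · simp only [outputAt, hI]
    rw [history_run_async P I s keep _ 0 ω hI t (le_max_left _ _), ht]
  · simp only [outputAt, hI]
    rw [history_run_async P I s keep _ 0 ω hI t' (le_max_right _ _), ht']

/-! ### The chain of crash times -/

/-- If agreement holds for all cuts between `S` and its complement, then all the decisions are the
same, for all inputs. -/
theorem exists_forall_decides_eq {ω : Pub × (Fin n → Priv)} {S : Finset (Fin n)}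
    [Nonempty (Fin n → Vin)] (hS : S.Nonempty) (hS' : Sᶜ.Nonempty)
    (hdec : ∀ (s : Fin n → Vin) (q : ℕ), ∀ i ∈ S, ∃ w, Decides P ω s (crashKeep S q) i w)
    (hdec' : ∀ (s : Fin n → Vin) (q : ℕ), ∀ i ∈ Sᶜ, ∃ w, Decides P ω s (crashKeep Sᶜ q) i w)
    (hagr : ∀ (s : Fin n → Vin) (p q : ℕ) i j w w', Decides P ω s (cutKeep S p q) i w →
      Decides P ω s (cutKeep S p q) j w' → w = w') :
    ∃ y, ∀ (s : Fin n → Vin) (q : ℕ) w,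
      (∀ i ∈ S, Decides P ω s (crashKeep S q) i w → w = y) ∧
      (∀ i ∈ Sᶜ, Decides P ω s (crashKeep Sᶜ q) i w → w = y) := by
  have key : ∀ (s : Fin n → Vin) (p q : ℕ), q ≤ p + 1 → p ≤ q + 1 → ∀ i ∈ S, ∀ j ∈ Sᶜ, ∀ w w',
      Decides P ω s (crashKeep S q) i w → Decides P ω s (crashKeep Sᶜ p) j w' → w = w' := by
    intro s p q h1 h2 i hi j hj w w' hw hw'
    rw [decides_crashKeep_iff_decides_cutKeep h1 hi] at hw
    rw [decides_crashKeep_iff_decides_cutKeep h2 hj, cutKeep_compl] at hw'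
    exact hagr s p q i j w w' hw hw'
  obtain ⟨s₀⟩ := ‹Nonempty (Fin n → Vin)›
  obtain ⟨i₀, hi₀⟩ := hS
  obtain ⟨j₀, hj₀⟩ := hS'
  obtain ⟨y, hy⟩ := hdec s₀ 0 i₀ hi₀
  refine ⟨y, fun s q => ?_⟩
  induction q with
  | zero =>
    have hB : ∀ w, ∀ j ∈ Sᶜ, Decides P ω s (crashKeep Sᶜ (0 : ℕ)) j w → w = y := by
      intro w j hj hw
      -- With crash time 0 on both sides the halves are isolated, so this mixture reproduces the
      -- decision of `S` on `s₀` and that of `Sᶜ` on `s`.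
      let s' : Fin n → Vin := fun i => if i ∈ S then s₀ i else s i
      have h1 : Decides P ω s' (crashKeep S (0 : ℕ)) i₀ y :=
        (decides_crashKeep_zero_congr (fun i hi => (if_pos hi).symm) hi₀).1 hy
      have h2 : Decides P ω s' (crashKeep Sᶜ (0 : ℕ)) j w :=
        (decides_crashKeep_zero_congr
          (fun i hi => (if_neg (Finset.mem_compl.1 hi)).symm) hj).1 hw
      exact (key s' 0 0 (by omega) (by omega) i₀ hi₀ j hj y w h1 h2).symm
    refine fun w => ⟨fun i hi hw => ?_, hB w⟩
    obtain ⟨w', hw'⟩ := hdec' s 0 j₀ hj₀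
    rw [key s 0 0 (by omega) (by omega) i hi j₀ hj₀ w w' hw hw', hB w' j₀ hj₀ hw']
  | succ q ih =>
    refine fun w => ⟨fun i hi hw => ?_, fun j hj hw => ?_⟩
    -- Raise one crash time to `q + 1` and compare with the other half at `q`, where the decision is
    -- known.
    · obtain ⟨w', hw'⟩ := hdec' s q j₀ hj₀
      rw [key s q (q + 1) (by omega) (by omega) i hi j₀ hj₀ w w' hw hw', (ih w').2 j₀ hj₀ hw']
    · obtain ⟨w', hw'⟩ := hdec s q i₀ hi₀
      rw [← key s (q + 1) q (by omega) (by omega) i₀ hi₀ j hj w' w hw' hw, (ih w').1 i₀ hi₀ hw']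

instance [Countable Vin] : Countable (InputConfig n ts Vin) :=
  Function.Injective.countable (f := InputConfig.input) fun I J h => by
    cases I; cases J; cases h; rfl

end Decision

end NetworkAgnosticBA

/-! ### The main theorem -/

open NetworkAgnosticBA in
theorem mainTheorem6 {n ts Δ : ℕ} (hts : 0 < ts) (hn : n = 2 * ts) (hΔ : 0 < Δ)
    {Vin Vout : Type*} [Countable Vin] [Nonempty Vout]
    {M C : Type*} (sig : M → Set (Fin n × C))
    {Pub Priv : Type*} [MeasurableSpace Pub] [MeasurableSpace Priv]
    (V : NetworkAgnosticBA.ValidityProperty n ts Vin Vout)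
    (hV : ∃ P : NetworkAgnosticBA.Protocol n Vin Vout M sig Pub Priv,
      NetworkAgnosticBA.IsSecureBA Δ 0 V P) :
    V.IsTrivial := by
  obtain ⟨P, hP⟩ := hV
  have := P.isProb
  rcases isEmpty_or_nonempty Vin with hE | hE
  -- Without inputs no party can be honest, so there are no input configurations and any value
  -- works.
  · obtain ⟨y⟩ := ‹Nonempty Vout›
    refine ⟨y, Set.mem_iInter.2 fun I => ?_⟩
    have hc := I.card_ge
    rw [Finset.filter_eq_empty_iff.2 fun i _ => by simp [Subsingleton.elim (I.input i) none]] at hc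
    simp at hc
    omega
  obtain ⟨v₀⟩ := hE
  have : Nonempty (Fin n → Vin) := ⟨fun _ => v₀⟩
  obtain ⟨S, -, hS⟩ := Finset.exists_subset_card_eq
    (s := (Finset.univ : Finset (Fin n))) (n := ts) (by simp; omega)
  have hSc : Sᶜ.card = ts := by
    rw [Finset.card_compl, hS, Fintype.card_fin]
    omega
  have hdec : ∀ S : Finset (Fin n), S.card = ts → ∀ᵐ ω ∂P.law, ∀ (s : Fin n → Vin) (q : ℕ),
      ∀ i ∈ S, ∃ w, Decides P ω s (crashKeep S q) i w := by
    intro S hS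
    refine ae_all_iff.2 fun s => ae_all_iff.2 fun q => ?_
    have hcard : n ≤ S.card + ts := by omega
    have h := sync_ae hΔ hP (restrictInputs s S hcard) (s := s) (fun i hi =>
      input_restrictInputs s S hcard (by rwa [parties_restrictInputs] at hi)) q
    rw [parties_restrictInputs] at h
    filter_upwards [h] with ω hω i hi using (hω i hi).1
  have hagr : ∀ᵐ ω ∂P.law, ∀ (s : Fin n → Vin) (p q : ℕ) i j w w',
      Decides P ω s (cutKeep S p q) i w → Decides P ω s (cutKeep S p q) j w' → w = w' :=
    ae_all_iff.2 fun s => ae_all_iff.2 fun p => ae_all_iff.2 fun q => async_ae hP s _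
  -- Here the corrupted parties follow the protocol forever, with the default input `v₀`.
  have hval : ∀ᵐ ω ∂P.law, ∀ I : InputConfig n ts Vin, ∀ i ∈ I.parties,
      (∃ w, Decides P ω (fun i => (I.input i).getD v₀) (crashKeep I.parties ⊤) i w) ∧
      ∀ w, Decides P ω (fun i => (I.input i).getD v₀) (crashKeep I.parties ⊤) i w → w ∈ V I := by
    refine ae_all_iff.2 fun I => sync_ae hΔ hP I (fun i hi => ?_) ⊤
    obtain ⟨v, hv⟩ := Option.isSome_iff_exists.1 (Finset.mem_filter.1 hi).2
    simp [hv]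
  obtain ⟨ω, h1, h2, h3, h4⟩ := ((hdec S hS).and ((hdec Sᶜ hSc).and (hagr.and hval))).exists
  obtain ⟨y, hy⟩ := exists_forall_decides_eq (Finset.card_pos.1 (by omega))
    (Finset.card_pos.1 (by omega)) h1 h2 h3
  refine ⟨y, Set.mem_iInter.2 fun I => ?_⟩
  have hpos : 0 < I.parties.card := by
    have := I.card_ge
    simp only [InputConfig.parties]
    omega
  obtain ⟨i, hi⟩ := Finset.card_pos.1 hpos
  obtain ⟨⟨w, hw⟩, hwV⟩ := h4 I i hi
  suffices w = y from this ▸ hwV w hw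
  by_cases hiS : i ∈ S
  · obtain ⟨q, hq⟩ := exists_decides_crashKeep_nat (S := S) hw
    exact (hy _ q w).1 i hiS hq
  · obtain ⟨q, hq⟩ := exists_decides_crashKeep_nat (S := Sᶜ) hw
    exact (hy _ q w).2 i (Finset.mem_compl.2 hiS) hq
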